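/- Let $p,q\ge 1$ and $n\ge\min(p,q)$ be integers. Let $F_{p,q,n}$ be the Segal–Bargmann (Fock) space of all entire functions $\psi(z,z')$ of $z=(z_{k,i})\in\mathbb{C}^{n\times p}$ and $z'=(z'_{k,j})\in\mathbb{C}^{n\times q}$ with $$\|\psi\|^2:=\frac1{\pi^{n(p+q)}}\int e^{-|z|^2-|z'|^2}\,|\psi(z,z')|^2\,\mathrm{d}z\,\mathrm{d}z'<\infty ,$$ where $\mathrm{d}z\,\mathrm{d}z'$ is the Lebesgue measure, $|z|^2=\sum_{k,i}|z_{k,i}|^2$ and $|z'|^2=\sum_{k,j}|z'_{k,j}|^2$. Let $F_{p,q,n}^{U(n)}$ be the subspace of those $\psi\in F_{p,q,n}$ with $\psi(uz,\overline{u}z')=\psi(z,z')$ for every unitary $u\in U(n)$. Put $Z_{i,j}(z,z')=\sum_{k=1}^n z_{k,i}z'_{k,j}$ for $1\le i\le p$, $1\le j\le q$, and for a function $f$ on $\mathbb{C}^{p\times q}$ put $(\Phi f)(z,z')=f\big((Z_{i,j}(z,z'))_{i,j}\big)$. Let $E_{p,q,n}$ be the space of entire functions $f$ on $\mathbb{C}^{p\times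 q}$ with $\|f\|_E:=\|\Phi f\|<\infty$. Then $f\mapsto\Phi f$ is an isometric linear isomorphism from $(E_{p,q,n},\|\cdot\|_E)$ onto $F_{p,q,n}^{U(n)}$. -/

import Mathlib

open MeasureTheory

noncomputable section

namespace SegalBargmann

/-- The phase space `ℂ^{np} × ℂ^{nq}`: a point is a pair `(z, z')` with entries `z k i` and
`z' k j`, for `k ∈ [n]`, `i ∈ [p]`, `j ∈ [q]`. Its volume is the Lebesgue measure. -/
abbrev Modes (p q n : ℕ) : Type := (Fin n → Fin p → ℂ) × (Fin n → Fin q → ℂ)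

variable {p q n : ℕ}

/-- The Gaussian weight `exp (-|z|² - |z'|²)`. -/
def weight (x : Modes p q n) : ℝ :=
  Real.exp (-(∑ k, ∑ i, ‖x.1 k i‖ ^ 2) - ∑ k, ∑ j, ‖x.2 k j‖ ^ 2)

/-- Square-integrability with respect to the Gaussian weight. -/
def SqIntegrable (ψ : Modes p q n → ℂ) : Prop :=
  Integrable (fun x => weight x * ‖ψ x‖ ^ 2)

/-- The sesquilinear form `π^{-n(p+q)} ∫ exp (-|z|² - |z'|²) conj (φ) ψ dz dz'`. -/
def gaussInner (φ ψ : Modes p q n → ℂ) : ℂ :=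
  (1 / (Real.pi : ℂ) ^ (n * (p + q))) *
    ∫ x, (weight x : ℂ) * ((starRingEnd ℂ) (φ x) * ψ x)

theorem isOpenPosMeasure_pi_pi (m r : ℕ) :
    (volume : Measure (Fin m → Fin r → ℂ)).IsOpenPosMeasure := by
  have h1 : (volume : Measure (Fin r → ℂ)).IsOpenPosMeasure :=
    inferInstanceAs (Measure.pi fun _ : Fin r => (volume : Measure ℂ)).IsOpenPosMeasure
  exact inferInstanceAs
    (Measure.pi fun _ : Fin m => (volume : Measure (Fin r → ℂ))).IsOpenPosMeasure

theorem isOpenPosMeasure_modes (p q n : ℕ) :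
    (volume : Measure (Modes p q n)).IsOpenPosMeasure := by
  have h1 := isOpenPosMeasure_pi_pi n p
  have h2 := isOpenPosMeasure_pi_pi n q
  exact inferInstanceAs ((volume : Measure (Fin n → Fin p → ℂ)).prod
    (volume : Measure (Fin n → Fin q → ℂ))).IsOpenPosMeasure

theorem weight_pos (x : Modes p q n) : 0 < weight x := Real.exp_pos _

theorem continuous_weight : Continuous (weight : Modes p q n → ℝ) := by
  unfold weight; fun_prop

theorem integrable_mul {φ ψ : Modes p q n → ℂ} (hφc : Continuous φ) (hψc : Continuous ψ)
    (hφ : SqIntegrable φ) (hψ : SqIntegrable ψ) :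
    Integrable (fun x => (weight x : ℂ) * ((starRingEnd ℂ) (φ x) * ψ x)) := by
  refine Integrable.mono' (Integrable.add hφ hψ) ?_ (Filter.Eventually.of_forall fun x => ?_)
  · have hw : Continuous (weight : Modes p q n → ℝ) := continuous_weight
    exact (Continuous.mul (Complex.continuous_ofReal.comp hw)
      ((Complex.continuous_conj.comp hφc).mul hψc)).aestronglyMeasurable
  · have hw := weight_pos x
    simp only [norm_mul, RCLike.norm_conj, Complex.norm_real, Real.norm_eq_abs, abs_of_pos hw,
      Pi.add_apply]
    rw [← mul_add]
    refine mul_le_mul_of_nonneg_left ?_ hw.le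
    nlinarith [sq_nonneg (‖φ x‖ - ‖ψ x‖), sq_nonneg ‖φ x‖, sq_nonneg ‖ψ x‖]

theorem SqIntegrable.add {φ ψ : Modes p q n → ℂ} (hφc : Continuous φ) (hψc : Continuous ψ)
    (hφ : SqIntegrable φ) (hψ : SqIntegrable ψ) : SqIntegrable (φ + ψ) := by
  have hw : Continuous (weight : Modes p q n → ℝ) := continuous_weight
  refine Integrable.mono' ((Integrable.add hφ hψ).const_mul 2) ?_
    (Filter.Eventually.of_forall fun x => ?_)
  · exact (hw.mul ((hφc.add hψc).norm.pow 2)).aestronglyMeasurable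
  · have hw := weight_pos x
    simp only [norm_mul, norm_pow, Real.norm_eq_abs, abs_of_pos hw, Pi.add_apply, abs_norm]
    rw [← mul_add, mul_left_comm]
    refine mul_le_mul_of_nonneg_left ?_ hw.le
    have h := norm_add_le (φ x) (ψ x)
    have h2 : ‖φ x + ψ x‖ ^ 2 ≤ (‖φ x‖ + ‖ψ x‖) ^ 2 := by gcongr
    nlinarith [sq_nonneg (‖φ x‖ - ‖ψ x‖)]

theorem SqIntegrable.smul (c : ℂ) {φ : Modes p q n → ℂ} (hφ : SqIntegrable φ) :
    SqIntegrable (c • φ) := by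
  refine (Integrable.const_mul hφ (‖c‖ ^ 2)).congr (Filter.Eventually.of_forall fun x => ?_)
  simp only [Pi.smul_apply, smul_eq_mul, norm_mul]
  ring

theorem SqIntegrable.zero : SqIntegrable (0 : Modes p q n → ℂ) := by
  simp [SqIntegrable]

variable (p q n)

/-- The Fock space `F_{p,q,n}` in the Segal–Bargmann representation: the entire functions on
`ℂ^{np} × ℂ^{nq}` that are square-integrable with respect to the Gaussian weight. -/
def fockSpace : Submodule ℂ (Modes p q n → ℂ) where
  carrier := {ψ | AnalyticOnNhd ℂ ψ Set.univ ∧ SqIntegrable ψ}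
  zero_mem' := ⟨analyticOnNhd_const, SqIntegrable.zero⟩
  add_mem' := fun hφ hψ => ⟨hφ.1.add hψ.1,
    SqIntegrable.add (continuousOn_univ.1 hφ.1.continuousOn)
      (continuousOn_univ.1 hψ.1.continuousOn) hφ.2 hψ.2⟩
  smul_mem' := fun c _ hψ =>
    ⟨(analyticOnNhd_const (v := c)).smul hψ.1, hψ.2.smul c⟩

variable {p q n}

theorem fockSpace_continuous (ψ : fockSpace p q n) : Continuous (ψ : Modes p q n → ℂ) :=
  continuousOn_univ.1 ψ.2.1.continuousOn

theorem gaussInner_self (ψ : Modes p q n → ℂ) :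
    gaussInner ψ ψ =
      ((1 / Real.pi ^ (n * (p + q)) * ∫ x, weight x * ‖ψ x‖ ^ 2 : ℝ) : ℂ) := by
  unfold gaussInner
  push_cast
  rw [← integral_complex_ofReal]
  congr 2
  funext x
  rw [← Complex.normSq_eq_conj_mul_self, Complex.normSq_eq_norm_sq]
  push_cast
  ring

/-- The inner product of the Fock space. -/
abbrev fockCore (p q n : ℕ) : InnerProductSpace.Core ℂ (fockSpace p q n) where
  inner φ ψ := gaussInner (φ : Modes p q n → ℂ) ψ
  conj_inner_symm φ ψ := by
    simp only [gaussInner, map_mul, ← integral_conj, map_div₀, map_one, map_pow,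
      Complex.conj_ofReal, Complex.conj_conj]
    congr 2
    funext x
    ring
  re_inner_nonneg φ := by
    rw [gaussInner_self]
    simp only [RCLike.re_to_complex, Complex.ofReal_re]
    exact mul_nonneg (by positivity)
      (integral_nonneg fun x => mul_nonneg (weight_pos x).le (sq_nonneg _))
  add_left φ ψ χ := by
    change gaussInner _ _ = gaussInner _ _ + gaussInner _ _
    unfold gaussInner
    rw [← mul_add, ← integral_add
      (integrable_mul (fockSpace_continuous φ) (fockSpace_continuous χ) φ.2.2 χ.2.2)
      (integrable_mul (fockSpace_continuous ψ) (fockSpace_continuous χ) ψ.2.2 χ.2.2)]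
    congr 2
    funext x
    simp only [Submodule.coe_add, Pi.add_apply, map_add]
    ring
  smul_left φ ψ c := by
    change gaussInner _ _ = _ * gaussInner _ _
    unfold gaussInner
    rw [mul_left_comm ((starRingEnd ℂ) c), ← integral_const_mul ((starRingEnd ℂ) c)]
    congr 2
    funext x
    simp only [Submodule.coe_smul, Pi.smul_apply, smul_eq_mul, map_mul]
    ring
  definite φ h := by
    change gaussInner (φ : Modes p q n → ℂ) φ = 0 at h
    rw [gaussInner_self, Complex.ofReal_eq_zero, mul_eq_zero] at h
    have h2 : ∫ x, weight x * ‖(φ : Modes p q n → ℂ) x‖ ^ 2 = 0 := by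
      refine h.resolve_left ?_
      positivity
    rw [integral_eq_zero_iff_of_nonneg
      (fun x => mul_nonneg (weight_pos x).le (sq_nonneg _)) φ.2.2] at h2
    have hc := fockSpace_continuous φ
    have hw : Continuous (weight : Modes p q n → ℝ) := continuous_weight
    have hv := isOpenPosMeasure_modes p q n
    have h3 := (Continuous.ae_eq_iff_eq volume (hw.mul (hc.norm.pow 2)) continuous_const).1 h2
    ext x
    have h4 : weight x * ‖(φ : Modes p q n → ℂ) x‖ ^ 2 = 0 := congrFun h3 x
    simpa [(weight_pos x).ne'] using h4

instance : NormedAddCommGroup (fockSpace p q n) :=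
  @InnerProductSpace.Core.toNormedAddCommGroup ℂ _ _ _ _ (fockCore p q n)

instance : InnerProductSpace ℂ (fockSpace p q n) :=
  InnerProductSpace.ofCore (fockCore p q n).toCore

/-- The norm of the Fock space is the Gaussian `L²` norm. -/
theorem fockSpace_norm_sq (ψ : fockSpace p q n) :
    ‖ψ‖ ^ 2 = 1 / Real.pi ^ (n * (p + q)) *
      ∫ x, weight x * ‖(ψ : Modes p q n → ℂ) x‖ ^ 2 := by
  have h : inner ℂ ψ ψ = gaussInner (ψ : Modes p q n → ℂ) ψ := rfl
  rw [gaussInner_self, inner_self_eq_norm_sq_to_K] at h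
  exact Complex.ofReal_injective (by simpa using h)

/-- The change of variables `z_i ↦ u z_i`, `z'_j ↦ ū z'_j`. -/
def act (u : Matrix (Fin n) (Fin n) ℂ) (x : Modes p q n) : Modes p q n :=
  (fun k i => ∑ l, u k l * x.1 l i, fun k j => ∑ l, (starRingEnd ℂ) (u k l) * x.2 l j)

/-- The operator `W_u`, `(W_u ψ)(z, z') = ψ (u z, ū z')`. -/
def W (u : Matrix.unitaryGroup (Fin n) ℂ) (ψ : Modes p q n → ℂ) : Modes p q n → ℂ :=
  fun x => ψ (act (u : Matrix (Fin n) (Fin n) ℂ) x)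

variable (p q n)

/-- The symmetric subspace `F_{p,q,n}^{U(n)}`. -/
def symmetricSubspace : Submodule ℂ (fockSpace p q n) where
  carrier := {ψ | ∀ u : Matrix.unitaryGroup (Fin n) ℂ,
    W u (ψ : Modes p q n → ℂ) = (ψ : Modes p q n → ℂ)}
  zero_mem' := fun _ => rfl
  add_mem' := fun {φ ψ} hφ hψ u => by
    funext x
    exact congrArg₂ (· + ·) (congrFun (hφ u) x) (congrFun (hψ u) x)
  smul_mem' := fun c ψ hψ u => by
    funext x
    exact congrArg (c * ·) (congrFun (hψ u) x)

variable {p q n}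

/-- The quadratic invariants `Z_{i,j} = ∑ k, z_{k,i} z'_{k,j}`. -/
def Z (x : Modes p q n) : Fin p → Fin q → ℂ := fun i j => ∑ k, x.1 k i * x.2 k j

theorem analyticOnNhd_Z : AnalyticOnNhd ℂ (Z : Modes p q n → Fin p → Fin q → ℂ) Set.univ := by
  intro x _
  refine AnalyticAt.pi fun i => AnalyticAt.pi fun j => ?_
  refine Finset.analyticAt_fun_sum _ fun k _ => AnalyticAt.mul ?_ ?_
  · exact (((ContinuousLinearMap.proj (R := ℂ) (φ := fun _ : Fin p => ℂ) i).comp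
      (ContinuousLinearMap.proj (R := ℂ) (φ := fun _ : Fin n => Fin p → ℂ) k)).comp
      (ContinuousLinearMap.fst ℂ _ _)).analyticAt x
  · exact (((ContinuousLinearMap.proj (R := ℂ) (φ := fun _ : Fin q => ℂ) j).comp
      (ContinuousLinearMap.proj (R := ℂ) (φ := fun _ : Fin n => Fin q → ℂ) k)).comp
      (ContinuousLinearMap.snd ℂ _ _)).analyticAt x

variable (p q n)

/-- The substitution `Φ`, which maps a function `f` of `pq` variables to `f (Z (z, z'))`. -/
def Φ : ((Fin p → Fin q → ℂ) → ℂ) →ₗ[ℂ] (Modes p q n → ℂ) where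
  toFun f := fun x => f (Z x)
  map_add' _ _ := rfl
  map_smul' _ _ := rfl

variable {p q n}

theorem analyticOnNhd_Φ {f : (Fin p → Fin q → ℂ) → ℂ} (hf : AnalyticOnNhd ℂ f Set.univ) :
    AnalyticOnNhd ℂ (Φ p q n f) Set.univ :=
  hf.comp analyticOnNhd_Z (Set.mapsTo_univ _ _)

variable (p q n)

/-- The space `E_{p,q,n}`: the entire functions `f` on `ℂ^{pq}` for which `Φ f` is
square-integrable with respect to the Gaussian weight. -/
def invariantSpace : Submodule ℂ ((Fin p → Fin q → ℂ) → ℂ) where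
  carrier := {f | AnalyticOnNhd ℂ f Set.univ ∧ SqIntegrable (Φ p q n f)}
  zero_mem' := ⟨analyticOnNhd_const, by rw [map_zero]; exact SqIntegrable.zero⟩
  add_mem' := fun {f g} hf hg => ⟨hf.1.add hg.1, by
    rw [map_add]
    exact SqIntegrable.add (continuousOn_univ.1 (analyticOnNhd_Φ hf.1).continuousOn)
      (continuousOn_univ.1 (analyticOnNhd_Φ hg.1).continuousOn) hf.2 hg.2⟩
  smul_mem' := fun c f hf => ⟨(analyticOnNhd_const (v := c)).smul hf.1, by
    rw [map_smul]; exact hf.2.smul c⟩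

/-- `Φ` as a linear map from `E_{p,q,n}` to the Fock space. -/
def ΦE : invariantSpace p q n →ₗ[ℂ] fockSpace p q n :=
  ((Φ p q n).comp (invariantSpace p q n).subtype).codRestrict (fockSpace p q n)
    (fun f => ⟨analyticOnNhd_Φ f.2.1, f.2.2⟩)

variable {p q n}

/-- The (semi)norm `‖f‖_E = ‖Φ f‖` on `E_{p,q,n}`, induced by the norm of the Fock space. -/
instance : SeminormedAddCommGroup (invariantSpace p q n) :=
  SeminormedAddCommGroup.induced _ _ (ΦE p q n)

instance : NormedSpace ℂ (invariantSpace p q n) :=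
  NormedSpace.induced ℂ _ _ (ΦE p q n)

end SegalBargmann

end

open Filter Topology NormedSpace
open scoped Matrix Matrix.Norms.Operator

namespace SegalBargmann

/-! `Z` is `U(n)`-invariant and, since `min p q ≤ n`, surjective, so `Φ` maps into the invariants
and is injective; it is isometric by the definition of the norm. The substance is that every
invariant entire `ψ` factors through `Z`. By the unitarian trick (`pairAct_exp_invariant`), `ψ` is
invariant under `(z, z') ↦ (g z, g⁻ᵀ z')` for every `g = exp X`. Take `p ≤ n`. For `z` near the
frame `[1; 0]`, such a `g` carries the frame to `z`, so `ψ (z, z')` equals a value over the frame;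
there, scaling the lower rows of `z'` to zero leaves only `Z (z, z')` (`eventually_eq_stdFrame`).
The identity theorem makes this global. -/

/-! ### Identity theorem from real to complex parameters -/

theorem eq_const_of_eq_const_on_real {F : ℂ → ℂ} (hF : AnalyticOnNhd ℂ F Set.univ) {c : ℂ}
    (h : ∀ t : ℝ, F t = c) (s : ℂ) : F s = c := by
  have key : F = fun _ => c := by
    refine AnalyticOnNhd.eq_of_frequently_eq (z₀ := 0) hF analyticOnNhd_const ?_
    have ht : Tendsto (fun t : ℝ => (t : ℂ)) (𝓝[≠] 0) (𝓝[≠] 0) := by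
      refine tendsto_nhdsWithin_iff.2 ⟨?_, ?_⟩
      · have := (Complex.continuous_ofReal.tendsto (0 : ℝ))
        rw [Complex.ofReal_zero] at this
        exact this.mono_left nhdsWithin_le_nhds
      · filter_upwards [self_mem_nhdsWithin] with t ht
        simpa using ht
    exact ht.frequently (Eventually.of_forall h).frequently
  exact congrFun key s

/-- An entire function of a complex matrix that is constant on the skew-Hermitian matrices is
constant. -/
theorem eq_const_of_eq_const_on_skewHermitian {n : ℕ} {F : Matrix (Fin n) (Fin n) ℂ → ℂ}
    (hF : AnalyticOnNhd ℂ F Set.univ) {c : ℂ} (h : ∀ X, Xᴴ = -X → F X = c)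
    (X : Matrix (Fin n) (Fin n) ℂ) : F X = c := by
  -- `X = A + iB` with `A`, `B` skew-Hermitian. Real combinations `sA + tB` stay skew-Hermitian; `t`
  -- and then `s` are made complex, and `s = 1`, `t = i` gives `X`.
  set A : Matrix (Fin n) (Fin n) ℂ := (1 / 2 : ℂ) • (X - Xᴴ) with hA
  set B : Matrix (Fin n) (Fin n) ℂ := (-Complex.I / 2 : ℂ) • (X + Xᴴ) with hB
  have hA' : Aᴴ = -A := by
    rw [hA, Matrix.conjTranspose_smul, ← smul_neg]
    simp
  have hB' : Bᴴ = -B := by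
    rw [hB, Matrix.conjTranspose_smul, ← neg_smul]
    simp [add_comm, neg_div]
  have hX : (1 : ℂ) • A + Complex.I • B = X := by
    rw [hA, hB, smul_smul, smul_smul]
    have : Complex.I * (-Complex.I / 2) = 1 / 2 := by
      linear_combination (-1 / 2 : ℂ) * Complex.I_mul_I
    rw [this, one_mul, ← smul_add]
    ext i j
    simp only [Matrix.smul_apply, Matrix.add_apply, Matrix.sub_apply, smul_eq_mul]
    ring
  have hreal (s t : ℝ) : F ((s : ℂ) • A + (t : ℂ) • B) = c := by
    refine h _ ?_
    simp [Matrix.conjTranspose_smul, hA', hB', add_comm]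
  have hline (s : ℝ) (t : ℂ) : F ((s : ℂ) • A + t • B) = c := by
    refine eq_const_of_eq_const_on_real (F := fun t : ℂ => F ((s : ℂ) • A + t • B)) ?_ (hreal s) t
    exact hF.comp (fun t _ => analyticAt_const.add (analyticAt_id.smul analyticAt_const))
      (Set.mapsTo_univ _ _)
  rw [← hX]
  refine eq_const_of_eq_const_on_real (F := fun s : ℂ => F (s • A + Complex.I • B)) ?_
    (fun s => hline s _) 1
  exact hF.comp (fun t _ => (analyticAt_id.smul analyticAt_const).add analyticAt_const)
    (Set.mapsTo_univ _ _)

/-! ### Complexifying the unitary action -/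

variable {p q n : ℕ}

theorem analyticAt_apply_apply {m r : ℕ} (k : Fin m) (i : Fin r) (z : Fin m → Fin r → ℂ) :
    AnalyticAt ℂ (fun z : Fin m → Fin r → ℂ => z k i) z :=
  ((ContinuousLinearMap.proj (R := ℂ) (φ := fun _ : Fin r => ℂ) i).comp
    (ContinuousLinearMap.proj (R := ℂ) (φ := fun _ : Fin m => Fin r → ℂ) k)).analyticAt z

theorem analyticAt_matrix_apply (k l : Fin n) (X : Matrix (Fin n) (Fin n) ℂ) :
    AnalyticAt ℂ (fun X : Matrix (Fin n) (Fin n) ℂ => X k l) X :=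
  (Matrix.entryLinearMap ℂ ℂ k l).toContinuousLinearMap.analyticAt X

theorem analyticAt_exp_matrix_apply (c : ℂ) (k l : Fin n) (X : Matrix (Fin n) (Fin n) ℂ) :
    AnalyticAt ℂ (fun X : Matrix (Fin n) (Fin n) ℂ => exp (c • X) k l) X := by
  have h1 : AnalyticAt ℂ (fun X : Matrix (Fin n) (Fin n) ℂ => c • X) X :=
    (analyticAt_const (v := c)).smul analyticAt_id
  have h2 : AnalyticAt ℂ (fun X : Matrix (Fin n) (Fin n) ℂ => exp (c • X)) X :=
    AnalyticAt.fun_comp (g := exp) (exp_analytic _) h1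
  exact AnalyticAt.fun_comp (g := fun X : Matrix (Fin n) (Fin n) ℂ => X k l)
    (analyticAt_matrix_apply k l _) h2

/-- The change of variables `z ↦ g z`, `z' ↦ h z'`. -/
def pairAct (g h : Matrix (Fin n) (Fin n) ℂ) (x : Modes p q n) : Modes p q n :=
  (fun k i => ∑ l, g k l * x.1 l i, fun k j => ∑ l, h k l * x.2 l j)

theorem pairAct_pairAct (g h g' h' : Matrix (Fin n) (Fin n) ℂ) (x : Modes p q n) :
    pairAct g h (pairAct g' h' x) = pairAct (g * g') (h * h') x := by
  have aux {r : ℕ} (a b : Matrix (Fin n) (Fin n) ℂ) (y : Fin n → Fin r → ℂ) (k : Fin n)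
      (i : Fin r) : ∑ l, a k l * ∑ m, b l m * y m i = ∑ m, (a * b) k m * y m i :=
    congrFun (congrFun (Matrix.mul_assoc a b (Matrix.of y)).symm k) i
  exact Prod.ext (funext₂ fun k i => aux _ _ _ _ _) (funext₂ fun k i => aux _ _ _ _ _)

theorem pairAct_one (x : Modes p q n) : pairAct 1 1 x = x := by
  refine Prod.ext (funext₂ fun k i => ?_) (funext₂ fun k i => ?_) <;>
  simp [pairAct, Matrix.one_apply]

/-- For unitary `u`, `ū` is the inverse transpose, which unlike conjugation depends holomorphically
on the group element. -/
theorem act_eq_pairAct (u : Matrix (Fin n) (Fin n) ℂ) (x : Modes p q n) :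
    act u x = pairAct u (uᴴ)ᵀ x := rfl

/-- The quadratic invariants are invariant under `U(n)`. -/
theorem Z_act (u : Matrix.unitaryGroup (Fin n) ℂ) (x : Modes p q n) :
    Z (act (u : Matrix (Fin n) (Fin n) ℂ) x) = Z x := by
  have aux : ((Matrix.of x.1)ᵀ * ((u : Matrix (Fin n) (Fin n) ℂ)ᵀ *
      ((u : Matrix (Fin n) (Fin n) ℂ)ᴴ)ᵀ) * Matrix.of x.2) = (Matrix.of x.1)ᵀ * Matrix.of x.2 := by
    rw [← Matrix.transpose_mul, ← Matrix.star_eq_conjTranspose, Unitary.coe_star_mul_self,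
      Matrix.transpose_one, Matrix.mul_one]
  funext i j
  have h := congrFun (congrFun aux i) j
  rw [← Matrix.mul_assoc, Matrix.mul_assoc, ← Matrix.transpose_mul] at h
  exact h

/-- The unitarian trick: `U(n)`-invariant entire functions are invariant under all
`exp X`. -/
theorem pairAct_exp_invariant {ψ : Modes p q n → ℂ} (hψ : AnalyticOnNhd ℂ ψ Set.univ)
    (hW : ∀ u : Matrix.unitaryGroup (Fin n) ℂ, W u ψ = ψ) (X : Matrix (Fin n) (Fin n) ℂ)
    (x : Modes p q n) : ψ (pairAct (exp X) (exp (-X))ᵀ x) = ψ x := by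
  refine eq_const_of_eq_const_on_skewHermitian
    (F := fun X => ψ (pairAct (exp X) (exp (-X))ᵀ x)) ?_ ?_ X
  · refine hψ.comp (fun X _ => ?_) (Set.mapsTo_univ _ _)
    refine AnalyticAt.prod ?_ ?_
    · refine AnalyticAt.pi fun k => AnalyticAt.pi fun i => ?_
      refine Finset.analyticAt_fun_sum _ fun l _ => AnalyticAt.mul ?_ analyticAt_const
      simpa using analyticAt_exp_matrix_apply 1 k l X
    · refine AnalyticAt.pi fun k => AnalyticAt.pi fun i => ?_
      refine Finset.analyticAt_fun_sum _ fun l _ => AnalyticAt.mul ?_ analyticAt_const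
      simpa using analyticAt_exp_matrix_apply (-1) l k X
  · intro Y hY
    have hstar : (exp Y)ᴴ = exp (-Y) := by rw [← Matrix.exp_conjTranspose, hY]
    have hinv : exp Y * exp (-Y) = 1 := by
      rw [← Matrix.exp_add_of_commute _ _ (Commute.refl Y).neg_right, add_neg_cancel, exp_zero]
    have hu : exp Y ∈ Matrix.unitaryGroup (Fin n) ℂ := by
      rw [Matrix.mem_unitaryGroup_iff, Matrix.star_eq_conjTranspose, hstar, hinv]
    have := congrFun (hW ⟨exp Y, hu⟩) x
    simp only [W, act_eq_pairAct, hstar] at this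
    exact this

/-! ### Reduction to the standard frame -/

/-- The `n × p` matrix `[1; 0]`. -/
def stdFrame (p n : ℕ) : Fin n → Fin p → ℂ := fun k i => if (k : ℕ) = i then 1 else 0

/-- Extension of an `n × p` matrix to a square matrix by the columns of the identity. -/
def completeColumns (z : Fin n → Fin p → ℂ) : Matrix (Fin n) (Fin n) ℂ :=
  fun k l => if h : (l : ℕ) < p then z k ⟨l, h⟩ else (1 : Matrix (Fin n) (Fin n) ℂ) k l

/-- Extension of a `p × q` matrix to an `n × q` matrix by zero rows. -/
def padRows (n : ℕ) (A : Fin p → Fin q → ℂ) : Fin n → Fin q → ℂ :=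
  fun k j => if h : (k : ℕ) < p then A ⟨k, h⟩ j else 0

theorem completeColumns_stdFrame : completeColumns (stdFrame p n) = 1 := by
  ext k l
  unfold completeColumns stdFrame
  split_ifs with h1 h2
  · rw [Fin.ext h2, Matrix.one_apply_eq]
  · rw [Matrix.one_apply_ne (fun h => h2 (congrArg Fin.val h))]
  · rfl

theorem sum_mul_stdFrame (hpn : p ≤ n) (a : Fin n → ℂ) (i : Fin p) :
    ∑ l, a l * stdFrame p n l i = a (Fin.castLE hpn i) := by
  rw [Finset.sum_eq_single (Fin.castLE hpn i)]
  · simp [stdFrame]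
  · intro l _ hl
    have : (l : ℕ) ≠ i := fun h => hl (Fin.ext h)
    simp [stdFrame, this]
  · simp

theorem continuous_completeColumns :
    Continuous (completeColumns : (Fin n → Fin p → ℂ) → Matrix (Fin n) (Fin n) ℂ) := by
  refine continuous_matrix fun k l => ?_
  unfold completeColumns
  split_ifs
  · fun_prop
  · fun_prop

theorem exp_diagonal_tail (s : ℂ) :
    exp (Matrix.diagonal fun k : Fin n => if (k : ℕ) < p then 0 else s) =
      Matrix.diagonal fun k : Fin n => if (k : ℕ) < p then 1 else Complex.exp s := by
  rw [Matrix.exp_diagonal]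
  congr 1
  funext k
  rw [Pi.coe_exp, ← Complex.exp_eq_exp_ℂ]
  split_ifs <;> simp

/-- The rows of `z'` beyond the first `p` do not affect the value at `([1; 0], z')`. -/
theorem stdFrame_eq_of_rows_eq (hpn : p ≤ n) {ψ : Modes p q n → ℂ}
    (hψ : AnalyticOnNhd ℂ ψ Set.univ)
    (hW : ∀ u : Matrix.unitaryGroup (Fin n) ℂ, W u ψ = ψ) (A : Fin p → Fin q → ℂ)
    (w : Fin n → Fin q → ℂ) (hw : ∀ i j, w (Fin.castLE hpn i) j = A i j) :
    ψ (stdFrame p n, w) = ψ (stdFrame p n, padRows n A) := by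
  have hc : Continuous ψ := continuousOn_univ.1 hψ.continuousOn
  let y : ℂ → Fin n → Fin q → ℂ := fun t k j => (if (k : ℕ) < p then 1 else t) * w k j
  have hy : Continuous y := by
    refine continuous_pi fun k => continuous_pi fun j => ?_
    by_cases h : (k : ℕ) < p <;> simp only [y, h, if_true, if_false] <;> fun_prop
  have h0 : y 0 = padRows n A := by
    funext k j
    by_cases h : (k : ℕ) < p
    · simp [y, padRows, h, ← hw]
    · simp [y, padRows, h]
  -- With `t = exp s`, the element `diag(1, …, 1, t⁻¹, …, t⁻¹)` fixes the frame and multiplies the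
  -- lower rows of `z'` by `t`. The value `t = 0` is reached only as a limit.
  have hne (t : ℂ) (ht : t ≠ 0) : ψ (stdFrame p n, y t) = ψ (stdFrame p n, w) := by
    obtain ⟨s, rfl⟩ : ∃ s, Complex.exp s = t := ⟨Complex.log t, Complex.exp_log ht⟩
    rw [← pairAct_exp_invariant hψ hW
      (Matrix.diagonal fun k : Fin n => if (k : ℕ) < p then 0 else -s) (stdFrame p n, w)]
    have hneg : -(Matrix.diagonal fun k : Fin n => if (k : ℕ) < p then (0 : ℂ) else -s) =
        Matrix.diagonal fun k : Fin n => if (k : ℕ) < p then 0 else s := by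
      rw [Matrix.diagonal_neg]
      congr 1
      funext k
      split_ifs <;> simp
    rw [hneg, exp_diagonal_tail, exp_diagonal_tail, Matrix.diagonal_transpose]
    congr 1
    refine Prod.ext (funext₂ fun k i => ?_) (funext₂ fun k j => ?_)
    · simp only [pairAct, Matrix.diagonal_apply, ite_mul, zero_mul, Finset.sum_ite_eq,
        Finset.mem_univ, if_true]
      by_cases h : (k : ℕ) < p
      · simp [h]
      · have : (k : ℕ) ≠ i := by omega
        simp [stdFrame, this]
    · simp [pairAct, Matrix.diagonal_apply, y]
  have ht : Tendsto (fun t : ℂ => ψ (stdFrame p n, y t)) (𝓝[≠] 0)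
      (𝓝 (ψ (stdFrame p n, padRows n A))) := by
    rw [← h0]
    exact ((hc.comp (continuous_const.prodMk hy)).tendsto 0).mono_left nhdsWithin_le_nhds
  have ht' : Tendsto (fun t : ℂ => ψ (stdFrame p n, y t)) (𝓝[≠] 0)
      (𝓝 (ψ (stdFrame p n, w))) := by
    refine tendsto_const_nhds.congr' ?_
    filter_upwards [self_mem_nhdsWithin] with t ht
    exact (hne t ht).symm
  exact tendsto_nhds_unique ht' ht

/-- Near the frame, `completeColumns z` is close to `1`, hence of the form `exp X`; undoing it moves
`z` to the frame. -/
theorem eventually_eq_stdFrame (hpn : p ≤ n) {ψ : Modes p q n → ℂ}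
    (hψ : AnalyticOnNhd ℂ ψ Set.univ)
    (hW : ∀ u : Matrix.unitaryGroup (Fin n) ℂ, W u ψ = ψ) :
    ∀ᶠ z in 𝓝 (stdFrame p n), ∀ z', ψ (z, z') = ψ (stdFrame p n, padRows n (Z (z, z'))) := by
  -- Inverse function theorem: the derivative of `exp` at `0` is the identity.
  have hexp : map (exp : Matrix (Fin n) (Fin n) ℂ → _) (𝓝 0) = 𝓝 1 := by
    have h : HasStrictFDerivAt (exp : Matrix (Fin n) (Fin n) ℂ → _)
      ((ContinuousLinearEquiv.refl ℂ _ : Matrix (Fin n) (Fin n) ℂ ≃L[ℂ] _) :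
        Matrix (Fin n) (Fin n) ℂ →L[ℂ] _) 0 := hasStrictFDerivAt_exp_zero
    have h' := h.map_nhds_eq_of_equiv
    rw [exp_zero] at h'
    exact h'
  have hrange : Set.range (exp : Matrix (Fin n) (Fin n) ℂ → _) ∈
      𝓝 (1 : Matrix (Fin n) (Fin n) ℂ) := by
    rw [← hexp]
    exact range_mem_map
  have hcont := (continuous_completeColumns (n := n) (p := p)).tendsto (stdFrame p n)
  rw [completeColumns_stdFrame] at hcont
  filter_upwards [hcont hrange] with z ⟨X, hX⟩ z'
  have hinv : exp (-X) * exp X = 1 := by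
    rw [← Matrix.exp_add_of_commute _ _ (Commute.refl X).neg_left, neg_add_cancel, exp_zero]
  -- `w = gᵀ z'` with `g = exp X`; its first `p` rows are `Z (z, z')`, because the first `p` columns
  -- of `g` are `z`.
  let w : Fin n → Fin q → ℂ := fun k j => ∑ l, completeColumns z l k * z' l j
  have hz : (z, z') = pairAct (exp X) (exp (-X))ᵀ (stdFrame p n, w) := by
    have h1 : (stdFrame p n, w) =
        ((stdFrame p n, (pairAct (p := p) 1 (exp X)ᵀ (z, z')).2) : Modes p q n) := by
      rw [hX]; rfl
    have h2 : (pairAct (exp X) (exp (-X))ᵀ (stdFrame p n, w)).2 =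
        (pairAct (p := p) (1 * 1) ((exp (-X))ᵀ * (exp X)ᵀ) (z, z')).2 := by
      rw [← pairAct_pairAct, h1]; rfl
    have h3 : (exp (-X))ᵀ * (exp X)ᵀ = 1 := by
      rw [← Matrix.transpose_mul, ← Matrix.exp_add_of_commute _ _ (Commute.refl X).neg_right,
        add_neg_cancel, exp_zero, Matrix.transpose_one]
    refine Prod.ext (funext₂ fun k i => ?_) ?_
    · simp only [pairAct, sum_mul_stdFrame hpn, hX]
      simp [completeColumns]
    · rw [h2, h3, mul_one, pairAct_one]
  rw [hz, pairAct_exp_invariant hψ hW, ← hz]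
  refine stdFrame_eq_of_rows_eq hpn hψ hW _ _ fun i j => ?_
  simp [w, Z, completeColumns]

theorem analyticAt_padRows (A : Fin p → Fin q → ℂ) :
    AnalyticAt ℂ (fun A : Fin p → Fin q → ℂ => padRows n A) A := by
  refine AnalyticAt.pi fun k => AnalyticAt.pi fun j => ?_
  unfold padRows
  split_ifs
  · exact analyticAt_apply_apply _ _ _
  · exact analyticAt_const

/-! ### Factorization through the quadratic invariants -/

theorem exists_eq_comp_Z_of_le (hpn : p ≤ n) {ψ : Modes p q n → ℂ}
    (hψ : AnalyticOnNhd ℂ ψ Set.univ)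
    (hW : ∀ u : Matrix.unitaryGroup (Fin n) ℂ, W u ψ = ψ) :
    ∃ f : (Fin p → Fin q → ℂ) → ℂ, AnalyticOnNhd ℂ f Set.univ ∧ ψ = fun x => f (Z x) := by
  have hf : AnalyticOnNhd ℂ (fun A : Fin p → Fin q → ℂ => ψ (stdFrame p n, padRows n A))
      Set.univ :=
    hψ.comp (fun A _ => analyticAt_const.prod (analyticAt_padRows A)) (Set.mapsTo_univ _ _)
  refine ⟨_, hf, ?_⟩
  refine hψ.eq_of_eventuallyEq (z₀ := (stdFrame p n, 0))
    (hf.comp analyticOnNhd_Z (Set.mapsTo_univ _ _)) ?_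
  have h := (eventually_eq_stdFrame hpn hψ hW).prod_inl_nhds (0 : Fin n → Fin q → ℂ)
  filter_upwards [h] with x hx using hx x.2

/-- When `q ≤ n`, exchanging `z` and `z'` replaces `u` by `ū`, again unitary, and transposes `Z`. -/
theorem exists_eq_comp_Z (hn : min p q ≤ n) {ψ : Modes p q n → ℂ}
    (hψ : AnalyticOnNhd ℂ ψ Set.univ)
    (hW : ∀ u : Matrix.unitaryGroup (Fin n) ℂ, W u ψ = ψ) :
    ∃ f : (Fin p → Fin q → ℂ) → ℂ, AnalyticOnNhd ℂ f Set.univ ∧ ψ = fun x => f (Z x) := by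
  rcases min_le_iff.1 hn with h | h
  · exact exists_eq_comp_Z_of_le h hψ hW
  · have hψ' : AnalyticOnNhd ℂ (fun x : Modes q p n => ψ x.swap) Set.univ :=
      hψ.comp (fun x _ => analyticAt_snd.prod analyticAt_fst) (Set.mapsTo_univ _ _)
    have hW' (u : Matrix.unitaryGroup (Fin n) ℂ) :
        W u (fun x : Modes q p n => ψ x.swap) = fun x => ψ x.swap := by
      have hu : ((u : Matrix (Fin n) (Fin n) ℂ)ᴴ)ᵀ ∈ Matrix.unitaryGroup (Fin n) ℂ := by
        have hs : star ((u : Matrix (Fin n) (Fin n) ℂ)ᴴ)ᵀ = (u : Matrix (Fin n) (Fin n) ℂ)ᵀ := by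
          ext k l
          simp [Matrix.star_apply]
        rw [Matrix.mem_unitaryGroup_iff', hs, ← Matrix.transpose_mul,
          ← Matrix.star_eq_conjTranspose, Unitary.coe_star_mul_self,
          Matrix.transpose_one]
      funext x
      have := congrFun (hW ⟨_, hu⟩) x.swap
      simpa [W, act, Matrix.conjTranspose_apply] using this
    obtain ⟨f, hf, hfψ⟩ := exists_eq_comp_Z_of_le h hψ' hW'
    refine ⟨fun A => f fun j i => A i j, hf.comp (fun A _ => ?_) (Set.mapsTo_univ _ _), ?_⟩
    · exact AnalyticAt.pi fun j => AnalyticAt.pi fun i => analyticAt_apply_apply _ _ _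
    · funext x
      refine (congrFun hfψ x.swap).trans ?_
      congr 1
      funext j i
      simp [Z, mul_comm]

theorem Z_stdFrame (hpn : p ≤ n) (A : Fin p → Fin q → ℂ) :
    Z (stdFrame p n, padRows n A) = A := by
  funext i j
  simp only [Z]
  simp_rw [mul_comm (stdFrame p n _ i)]
  rw [sum_mul_stdFrame hpn (fun k => padRows n A k j)]
  simp [padRows]

theorem Z_surjective (hn : min p q ≤ n) : Function.Surjective (Z : Modes p q n → _) := by
  intro A
  rcases min_le_iff.1 hn with h | h
  · exact ⟨_, Z_stdFrame h A⟩
  · refine ⟨(stdFrame q n, padRows n fun j i => A i j).swap, ?_⟩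
    funext i j
    have := congrFun (congrFun (Z_stdFrame h fun j i => A i j) j) i
    simpa [Z, mul_comm] using this

theorem ΦE_mem_symmetricSubspace (f : invariantSpace p q n) :
    ΦE p q n f ∈ symmetricSubspace p q n := by
  intro u
  funext x
  exact congrArg (f : (Fin p → Fin q → ℂ) → ℂ) (Z_act u x)

end SegalBargmann

theorem theorem1 (p q n : ℕ) (hp : 1 ≤ p) (hq : 1 ≤ q) (hn : min p q ≤ n) :
    ∃ T : SegalBargmann.invariantSpace p q n ≃ₗᵢ[ℂ] SegalBargmann.symmetricSubspace p q n,
      ∀ f : SegalBargmann.invariantSpace p q n,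
        ((T f : SegalBargmann.fockSpace p q n) : SegalBargmann.Modes p q n → ℂ) =
          SegalBargmann.Φ p q n (f : (Fin p → Fin q → ℂ) → ℂ) := by
  let L : SegalBargmann.invariantSpace p q n →ₗ[ℂ] SegalBargmann.symmetricSubspace p q n :=
    (SegalBargmann.ΦE p q n).codRestrict _ SegalBargmann.ΦE_mem_symmetricSubspace
  have hinj : Function.Injective L := by
    intro f g hfg
    refine Subtype.ext (funext fun A => ?_)
    obtain ⟨x, rfl⟩ := SegalBargmann.Z_surjective hn A
    exact congrFun (congrArg (fun ψ : SegalBargmann.symmetricSubspace p q n =>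
      ((ψ : SegalBargmann.fockSpace p q n) : SegalBargmann.Modes p q n → ℂ)) hfg) x
  have hsurj : Function.Surjective L := by
    intro ψ
    obtain ⟨f, hf, hfψ⟩ := SegalBargmann.exists_eq_comp_Z hn ψ.1.2.1 ψ.2
    -- Membership of `f` in `E` costs nothing: `Φ f` is `ψ` itself.
    have hint : SegalBargmann.SqIntegrable (SegalBargmann.Φ p q n f) := by
      have h := ψ.1.2.2
      rwa [hfψ] at h
    exact ⟨⟨f, hf, hint⟩, Subtype.ext (Subtype.ext hfψ.symm)⟩
  exact ⟨⟨LinearEquiv.ofBijective L ⟨hinj, hsurj⟩, fun f => rfl⟩, fun f => rfl⟩
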